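/- Let $\mathbb{K}=\mathbb{R}$ or $\mathbb{C}$, $\mathbb{N}=\{1,2,3,\dots\}$, $N\ge 2$, $[l]=\{1,\dots,l\}$, and let $c_0(\mathbb{N})$ be the space of $\mathbb{K}$-valued null sequences $(x_j)_{j\ge 1}$ with the sup norm. For $s\in[N]$ let $f_s:\mathbb{N}\to\mathbb{N}$ be strictly increasing with $f_s(1)>1$, let $w_s=(w_{s,j})_{j\ge 1}$ be a sequence in $\mathbb{K}$ such that $(w_{s,f_s(j)})_{j\ge 1}$ is bounded, and let $T_s=T_{f_s,w_s}$ be the unilateral pseudo-shift on $c_0(\mathbb{N})$ given by $(T_sx)_j=w_{s,f_s(j)}\,x_{f_s(j)}$, $j\ge 1$. Write $f_s^n$ for the $n$-th iterate of $f_s$ and $W^s_{j,n}=\prod_{\nu=1}^n w_{s,f_s^\nu(j)}$. Let $\mathcal{A}$ be either the family $\mathcal{A}_{uBd}$ of all $A\subseteq\{0,1,2,\dots\}$ with positive upper Banach density $\limsup_{M\to\infty}\max_{k\ge1}\frac{\operatorname{card}(A\cap[k+1,k+M])}{M}>0$, or the family $\mathcal{A}_{ud}$ of all such $A$ with positive upper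 density $\limsup_{M\to\infty}\frac{\operatorname{card}\{n\le M:\,n\in A\}}{M}>0$. Assume that $\mathcal{A}$ is $(f_s)_{s=1}^N$-almost partition regular: for every $l\ge1$ and every $B\in\mathcal{A}$ there is $A\in\mathcal{A}$ with $A\subseteq B$ and $f_s^m([l])\cap f_t^n([l])=\emptyset$ for all $m\ne n$ in $A$ and all $s,t\in[N]$. The operators $T_1,\dots,T_N$ are called disjoint $\mathcal{A}$-hypercyclic if there is $x\in c_0(\mathbb{N})$ such that for every non-empty open set $U\subseteq c_0(\mathbb{N})^N$ we have $\{n\ge 0: (T_1^nx,\dots,T_N^nx)\in U\}\in\mathcal{A}$. Theorem. $T_1,\dots,T_N$ are disjoint $\mathcal{A}$-hypercyclic if and only if for every $l\ge1$, every family $(a_{s,j})_{s\in[N],\,j\in[l]}$ of nonzero scalars in $\mathbb{K}$ and every $\varepsilon>0$ there exists $A\in\mathcal{A}$ such that 1. for all $j\in[l]$ and $s\in[N]$, $\lim_{n\to\infty,\ n\in A}|W^s_{j,n}|=\infty$; 2. for all $j\in[l]$, $n,m\in A$ and $s,t\in[N]$ with $f_t^m(j)\in f_s^n((l,+\infty))$,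 $$\frac{|W^s_{f_s^{-n}(f_t^m(j)),n}|}{|W^t_{j,m}|}\le\varepsilon;$$ 3. for all $n\in A$, all $s\ne t$ in $[N]$ and all $j\in f_t^n([l])\cap f_s^n([l])$, $$\left|\frac{W^s_{f_s^{-n}(j),n}}{W^t_{f_t^{-n}(j),n}}-\frac{a_{s,f_s^{-n}(j)}}{a_{t,f_t^{-n}(j)}}\right|\le\varepsilon.$$ (By condition 1 the denominators in conditions 2 and 3 are nonzero.) -/

import Mathlib

open Set Filter Topology
open scoped ZeroAtInfty

noncomputable section

/-- The upper density `limsup_N card {n ≤ N : n ∈ A} / N` of a set of natural numbers. -/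
def upperDensity (A : Set ℕ) : ℝ :=
  limsup (fun N : ℕ => ((A ∩ Iic N).ncard : ℝ) / N) atTop

/-- The upper Banach density `limsup_N max_{k ≥ 1} card (A ∩ [k+1, k+N]) / N`. For each `N` the
supremum is over finitely many values in `[0, 1]`, so it is a maximum. -/
def upperBanachDensity (A : Set ℕ) : ℝ :=
  limsup (fun N : ℕ => ⨆ k : ℕ+, ((A ∩ Icc ((k : ℕ) + 1) (k + N)).ncard : ℝ) / N) atTop

/-- The family of sets of positive upper density. -/
def familyUd : Set (Set ℕ) := {A | 0 < upperDensity A}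

/-- The family of sets of positive upper Banach density. -/
def familyUBd : Set (Set ℕ) := {A | 0 < upperBanachDensity A}

/-- `y` is an `𝒜`-hypercyclic vector for the operator `S`. -/
def IsHypercyclicVector {𝕜 Y : Type*} [NormedField 𝕜] [AddCommGroup Y] [Module 𝕜 Y]
    [TopologicalSpace Y] (𝒜 : Set (Set ℕ)) (S : Y →L[𝕜] Y) (y : Y) : Prop :=
  ∀ U : Set Y, IsOpen U → U.Nonempty → {n : ℕ | (S ^ n) y ∈ U} ∈ 𝒜

/-- The direct sum operator `T₁ ⊕ ⋯ ⊕ T_N` on `X^N` (with the product topology). -/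
def directSumOp {𝕜 X : Type*} [NormedField 𝕜] [AddCommGroup X] [Module 𝕜 X]
    [TopologicalSpace X] {N : ℕ} (T : Fin N → X →L[𝕜] X) : (Fin N → X) →L[𝕜] (Fin N → X) :=
  ContinuousLinearMap.pi fun s => (T s).comp (ContinuousLinearMap.proj s)

/-- `T₁, …, T_N` are disjoint `𝒜`-hypercyclic: the direct sum operator has an `𝒜`-hypercyclic
vector of the form `(x, …, x)`. -/
def DisjointHypercyclic {𝕜 X : Type*} [NormedField 𝕜] [AddCommGroup X] [Module 𝕜 X]
    [TopologicalSpace X] {N : ℕ} (𝒜 : Set (Set ℕ)) (T : Fin N → X →L[𝕜] X) : Prop :=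
  ∃ x : X, IsHypercyclicVector 𝒜 (directSumOp T) (fun _ => x)

/-- The pseudo-shift `T_{f,w}` on `c₀`, `(T_{f,w} x)_j = w_{f(j)} x_{f(j)}` for `j ≥ 1`.
The space `c₀(ℕ)`, with coordinates indexed by `1, 2, 3, …`, is `C₀(ℕ+, 𝕜)` with the sup norm. -/
def pseudoShift {𝕜 : Type*} [RCLike 𝕜] (f : ℕ+ → ℕ+) (w : ℕ+ → 𝕜) (hf : StrictMono f)
    (hw : ∃ C : ℝ, ∀ j, ‖w (f j)‖ ≤ C) : C₀(ℕ+, 𝕜) →L[𝕜] C₀(ℕ+, 𝕜) :=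
  LinearMap.mkContinuousOfExistsBound
    { toFun := fun x =>
        { toFun := fun j => w (f j) * x (f j)
          continuous_toFun := continuous_of_discreteTopology
          zero_at_infty' := by
            obtain ⟨C, hC⟩ := hw
            have hx : Tendsto (fun j => x (f j)) (cocompact ℕ+) (𝓝 0) := by
              refine (zero_at_infty x).comp ?_
              rw [cocompact_eq_cofinite]
              exact hf.injective.tendsto_cofinite
            have h2 : Tendsto (fun j => C * ‖x (f j)‖) (cocompact ℕ+) (𝓝 0) := by
              simpa using hx.norm.const_mul C
            refine squeeze_zero_norm (fun j => ?_) h2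
            rw [norm_mul]
            exact mul_le_mul_of_nonneg_right (hC j) (norm_nonneg _) }
      map_add' := fun x y => by ext j; simp [mul_add]
      map_smul' := fun c x => by ext j; simp [mul_left_comm] }
    (by
      obtain ⟨C, hC⟩ := hw
      have hC0 : 0 ≤ C := (norm_nonneg _).trans (hC 1)
      refine ⟨C, fun x => ?_⟩
      have hx : ∀ j, ‖x j‖ ≤ ‖x‖ := fun j => by
        rw [← ZeroAtInftyContinuousMap.norm_toBCF_eq_norm]
        exact x.toBCF.norm_coe_le_norm j
      rw [← ZeroAtInftyContinuousMap.norm_toBCF_eq_norm]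
      refine (BoundedContinuousFunction.norm_le (by positivity)).2 fun j => ?_
      change ‖w (f j) * x (f j)‖ ≤ _
      rw [norm_mul]
      exact mul_le_mul (hC j) (hx _) (norm_nonneg _) hC0)

theorem pseudoShift_apply {𝕜 : Type*} [RCLike 𝕜] (f : ℕ+ → ℕ+) (w : ℕ+ → 𝕜) (hf : StrictMono f)
    (hw : ∃ C : ℝ, ∀ j, ‖w (f j)‖ ≤ C) (x : C₀(ℕ+, 𝕜)) (j : ℕ+) :
    pseudoShift f w hf hw x j = w (f j) * x (f j) := rfl

/-- The weight products `W_{j,n} = ∏_{ν=1}^n w_{f^ν(j)}`. -/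
def weightProd {𝕜 : Type*} [RCLike 𝕜] (f : ℕ+ → ℕ+) (w : ℕ+ → 𝕜) (j : ℕ+) (n : ℕ) : 𝕜 :=
  ∏ ν ∈ Finset.Icc 1 n, w (f^[ν] j)

/-- The family `𝒜` is `(f_s)`-almost partition regular: for all `l ≥ 1` and `B ∈ 𝒜` there is
`A ⊆ B` in `𝒜` such that `f_s^m([l])` and `f_t^n([l])` are disjoint for all `m ≠ n` in `A` and
all `s, t`. Here `[l] = {1, …, l}` is `Iic l` in `ℕ+`. -/
def AlmostPartitionRegular {N : ℕ} (f : Fin N → ℕ+ → ℕ+) (𝒜 : Set (Set ℕ)) : Prop :=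
  ∀ l : ℕ+, ∀ B ∈ 𝒜, ∃ A ∈ 𝒜, A ⊆ B ∧
    ∀ m ∈ A, ∀ n ∈ A, m ≠ n → ∀ s t : Fin N,
      ((f s)^[m] '' Iic l) ∩ ((f t)^[n] '' Iic l) = ∅

end

/-! Necessity is a direct reading of the orbit. If `x` is a disjoint hypercyclic vector, let `A` be
the set of times when all orbits are within `δ` of `(a_{s,1}, …, a_{s,l}, 0, …)`. For `n ∈ A` the
products `W^s_{i,n} x_{f_s^n(i)}` are near `a_{s,i}` when `i ≤ l` and near `0` when `i > l`. Since
`x` is null, the weights blow up; dividing two such products at a common point cancels the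
coordinate of `x` and leaves the quotients of conditions 2 and 3 (`weights_of_disjointHypercyclic`).

Sufficiency is a Baire category argument. Positive (Banach) density is witnessed by finite subsets
of arbitrarily late tails, so the vectors visiting a given ball along such witnesses form a
countable intersection of open sets (`IsUpperFamily`, `disjointHypercyclic_of_isUpperFamily`). For
their density, a finitely supported vector is perturbed by a small `z` carrying `a_{s,j} /
W^s_{j,n}` at `f_s^n(j)`, for late `n ∈ A` (`exists_near_orbit_near_target`). Almost partition
regularity separates distinct times, condition 3 reconciles collisions between operators at the same
time, and condition 2 controls the coordinates beyond `l`. -/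

/-! ### Families given by finite witnesses -/

/-- A family of sets of natural numbers is an upper family if membership of each of its elements
`A` is witnessed, through countably many conditions, by finite subsets of the tails of `A`, in such
a way that every set meeting the same conditions belongs to the family. -/
def IsUpperFamily (𝒜 : Set (Set ℕ)) : Prop :=
  ∀ A ∈ 𝒜, ∃ F : ℕ → Set (Finset ℕ),
    (∀ m n₀, ∃ S ∈ F m, ∀ n ∈ S, n ∈ A ∧ n₀ ≤ n) ∧
    ∀ B : Set ℕ, (∀ m, ∃ S ∈ F m, (S : Set ℕ) ⊆ B) → B ∈ 𝒜

theorem ncard_inter_le_ncard_sdiff_Iio_add (A I : Set ℕ) (n₀ : ℕ) :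
    (A ∩ I).ncard ≤ ((A ∩ I) \ Iio n₀).ncard + n₀ := by
  have h := Set.ncard_le_ncard_sdiff_add_ncard (A ∩ I) (Iio n₀) (Set.finite_Iio n₀)
  have h2 : (Iio n₀).ncard = n₀ := by
    rw [← Finset.coe_Iio, Set.ncard_coe_finset, Nat.card_Iio]
  omega

/-- If `A` has more than `c` elements in a finite set `I` and `n₀ ≤ c - e`, then more than `e` of
them are at least `n₀`. -/
theorem exists_finset_tail {A I : Set ℕ} (hI : I.Finite) {n₀ : ℕ} {c e : ℝ}
    (h : c < (A ∩ I).ncard) (hn : c - e ≥ n₀) :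
    ∃ S : Finset ℕ, (S : Set ℕ) ⊆ I ∧ e < S.card ∧ ∀ n ∈ S, n ∈ A ∧ n₀ ≤ n := by
  have hfin : ((A ∩ I) \ Iio n₀).Finite := (hI.subset inter_subset_right).subset sdiff_subset
  refine ⟨hfin.toFinset, ?_, ?_, ?_⟩
  · intro n hn
    simp at hn
    exact hn.1.2
  · have h1 := ncard_inter_le_ncard_sdiff_Iio_add A I n₀
    rw [Set.ncard_eq_toFinset_card _ hfin] at h1
    have : ((A ∩ I).ncard : ℝ) ≤ hfin.toFinset.card + n₀ := by exact_mod_cast h1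
    linarith
  · intro n hn
    simp at hn
    exact ⟨hn.1.1, hn.2⟩

/-- The bound is 2 rather than 1 because `Iic M` contains 0 and so has `M + 1` elements. -/
theorem ncard_inter_Iic_div_le (A : Set ℕ) (M : ℕ) :
    ((A ∩ Iic M).ncard : ℝ) / M ≤ 2 := by
  rcases Nat.eq_zero_or_pos M with rfl | hM
  · simp
  have h : (A ∩ Iic M).ncard ≤ M + 1 := by
    refine (Set.ncard_le_ncard inter_subset_right (Set.finite_Iic M)).trans ?_
    rw [← Finset.coe_Iic, Set.ncard_coe_finset, Nat.card_Iic]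
  have h' : ((A ∩ Iic M).ncard : ℝ) ≤ M + 1 := by exact_mod_cast h
  have h1 : (1 : ℝ) ≤ M := by exact_mod_cast hM
  rw [div_le_iff₀ (by linarith)]
  linarith

theorem ncard_inter_Icc_div_le (A : Set ℕ) (k M : ℕ) :
    ((A ∩ Icc (k + 1) (k + M)).ncard : ℝ) / M ≤ 1 := by
  have h : (A ∩ Icc (k + 1) (k + M)).ncard ≤ M := by
    refine (Set.ncard_le_ncard inter_subset_right (Set.finite_Icc _ _)).trans ?_
    rw [← Finset.coe_Icc, Set.ncard_coe_finset, Nat.card_Icc]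
    omega
  exact div_le_one_of_le₀ (by exact_mod_cast h) (by positivity)

theorem bddAbove_banach (A : Set ℕ) (M : ℕ) :
    BddAbove (range fun k : ℕ+ => ((A ∩ Icc ((k : ℕ) + 1) (k + M)).ncard : ℝ) / M) := by
  refine ⟨1, ?_⟩
  rintro _ ⟨k, rfl⟩
  exact ncard_inter_Icc_div_le A k M

theorem isUpperFamily_familyUd : IsUpperFamily familyUd := by
  intro A hA
  -- Of the density `2 * d`, one `d` pays for discarding the elements below `n₀`, once `n₀ ≤ d * M`;
  -- the other survives in the witness.
  obtain ⟨d, hd, hdA⟩ : ∃ d : ℝ, 0 < d ∧ 2 * d < upperDensity A :=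
    ⟨upperDensity A / 4, by have : 0 < upperDensity A := hA; linarith,
      by have : 0 < upperDensity A := hA; linarith⟩
  refine ⟨fun m => {S | ∃ M : ℕ, m ≤ M ∧ 0 < M ∧ (S : Set ℕ) ⊆ Iic M ∧ d * M < S.card}, ?_, ?_⟩
  · intro m n₀
    have hfreq := frequently_lt_of_lt_limsup (f := atTop)
      (isCoboundedUnder_le_of_le atTop (x := (0 : ℝ)) fun M => by positivity) hdA
    obtain ⟨K, hK⟩ := exists_nat_ge (n₀ / d)
    obtain ⟨M, hM, hlt⟩ := (frequently_atTop.1 hfreq) (m + K + 1)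
    have hMpos : (0 : ℝ) < M := by exact_mod_cast (by omega : 0 < M)
    rw [lt_div_iff₀ hMpos] at hlt
    have hKM : (K : ℝ) ≤ M := by exact_mod_cast (by omega : K ≤ M)
    have hn : (n₀ : ℝ) ≤ d * M := by
      rw [div_le_iff₀ hd] at hK
      nlinarith
    obtain ⟨S, hS, hc, hmem⟩ := exists_finset_tail (e := d * M) (Set.finite_Iic M) hlt
      (n₀ := n₀) (by linarith)
    exact ⟨S, ⟨M, by omega, by omega, hS, hc⟩, hmem⟩
  · intro B hB
    refine hd.trans_le (le_limsup_of_frequently_le ?_ ?_)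
    · refine frequently_atTop.2 fun m => ?_
      obtain ⟨S, ⟨M, hmM, hM, hS, hc⟩, hSB⟩ := hB m
      refine ⟨M, hmM, ?_⟩
      have hle : S.card ≤ (B ∩ Iic M).ncard := by
        rw [← Set.ncard_coe_finset]
        exact Set.ncard_le_ncard (subset_inter hSB hS) ((Set.finite_Iic M).inter_of_right _)
      rw [le_div_iff₀ (by exact_mod_cast hM)]
      exact hc.le.trans (by exact_mod_cast hle)
    · exact isBoundedUnder_of ⟨2, ncard_inter_Iic_div_le B⟩

theorem isUpperFamily_familyUBd : IsUpperFamily familyUBd := by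
  intro A hA
  obtain ⟨d, hd, hdA⟩ : ∃ d : ℝ, 0 < d ∧ 2 * d < upperBanachDensity A :=
    ⟨upperBanachDensity A / 4, by have : 0 < upperBanachDensity A := hA; linarith,
      by have : 0 < upperBanachDensity A := hA; linarith⟩
  refine ⟨fun m => {S | ∃ M : ℕ, m ≤ M ∧ 0 < M ∧ ∃ k : ℕ+,
    (S : Set ℕ) ⊆ Icc ((k : ℕ) + 1) (k + M) ∧ d * M < S.card}, ?_, ?_⟩
  · intro m n₀
    have hfreq := frequently_lt_of_lt_limsup (f := atTop)
      (isCoboundedUnder_le_of_le atTop (x := (0 : ℝ)) fun M =>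
        Real.iSup_nonneg fun k => by positivity) hdA
    obtain ⟨K, hK⟩ := exists_nat_ge (n₀ / d)
    obtain ⟨M, hM, hlt⟩ := (frequently_atTop.1 hfreq) (m + K + 1)
    obtain ⟨k, hk⟩ := exists_lt_of_lt_ciSup hlt
    have hMpos : (0 : ℝ) < M := by exact_mod_cast (by omega : 0 < M)
    rw [lt_div_iff₀ hMpos] at hk
    have hKM : (K : ℝ) ≤ M := by exact_mod_cast (by omega : K ≤ M)
    have hn : (n₀ : ℝ) ≤ d * M := by
      rw [div_le_iff₀ hd] at hK
      nlinarith
    obtain ⟨S, hS, hc, hmem⟩ := exists_finset_tail (e := d * M) (Set.finite_Icc _ _) hk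
      (n₀ := n₀) (by linarith)
    exact ⟨S, ⟨M, by omega, by omega, k, hS, hc⟩, hmem⟩
  · intro B hB
    refine hd.trans_le (le_limsup_of_frequently_le ?_ ?_)
    · refine frequently_atTop.2 fun m => ?_
      obtain ⟨S, ⟨M, hmM, hM, k, hS, hc⟩, hSB⟩ := hB m
      refine ⟨M, hmM, ?_⟩
      refine le_trans ?_ (le_ciSup (bddAbove_banach B M) k)
      have hle : S.card ≤ (B ∩ Icc ((k : ℕ) + 1) (k + M)).ncard := by
        rw [← Set.ncard_coe_finset]
        exact Set.ncard_le_ncard (subset_inter hSB hS) ((Set.finite_Icc _ _).inter_of_right _)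
      rw [le_div_iff₀ (by exact_mod_cast hM)]
      exact hc.le.trans (by exact_mod_cast hle)
    · exact isBoundedUnder_of ⟨1, fun M => ciSup_le fun k => ncard_inter_Icc_div_le B k M⟩

/-! ### Null sequences -/

section NullSequences

variable {𝕜 : Type*} [RCLike 𝕜]

theorem norm_apply_le_norm (x : C₀(ℕ+, 𝕜)) (p : ℕ+) : ‖x p‖ ≤ ‖x‖ := by
  rw [← ZeroAtInftyContinuousMap.norm_toBCF_eq_norm]
  exact x.toBCF.norm_coe_le_norm p

theorem norm_le_of_forall_apply {x : C₀(ℕ+, 𝕜)} {C : ℝ} (hC : 0 ≤ C) (h : ∀ p, ‖x p‖ ≤ C) :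
    ‖x‖ ≤ C := by
  rw [← ZeroAtInftyContinuousMap.norm_toBCF_eq_norm]
  exact (BoundedContinuousFunction.norm_le hC).2 h

theorem finite_setOf_le_norm_apply (x : C₀(ℕ+, 𝕜)) {ε : ℝ} (hε : 0 < ε) :
    {p | ε ≤ ‖x p‖}.Finite := by
  have h := (zero_at_infty x).norm
  rw [cocompact_eq_cofinite, norm_zero] at h
  have h2 := h.eventually (gt_mem_nhds hε)
  simpa [Filter.eventually_cofinite] using h2

/-- The null sequence with the given coordinates. -/
def nullSequence (g : ℕ+ → 𝕜) (hg : ∀ ε : ℝ, 0 < ε → {p | ε ≤ ‖g p‖}.Finite) : C₀(ℕ+, 𝕜) where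
  toFun := g
  continuous_toFun := continuous_of_discreteTopology
  zero_at_infty' := by
    rw [cocompact_eq_cofinite, tendsto_zero_iff_norm_tendsto_zero]
    refine (nhds_basis_abs_sub_lt (0 : ℝ)).tendsto_right_iff.2 fun ε hε => ?_
    simpa [Filter.eventually_cofinite] using hg ε hε

@[simp]
theorem nullSequence_apply (g : ℕ+ → 𝕜) (hg : ∀ ε : ℝ, 0 < ε → {p | ε ≤ ‖g p‖}.Finite) (p : ℕ+) :
    nullSequence g hg p = g p := rfl

/-- The sequence `(b 1, …, b l, 0, 0, …)`. -/
def truncatedSequence (l : ℕ+) (b : ℕ+ → 𝕜) : C₀(ℕ+, 𝕜) :=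
  nullSequence (fun p => if p ≤ l then b p else 0) fun ε hε => by
    refine (Set.finite_Iic l).subset fun p hp => ?_
    by_contra h
    have h' : ¬ p ≤ l := h
    simp [h'] at hp
    linarith

theorem truncatedSequence_apply_of_le {l p : ℕ+} (b : ℕ+ → 𝕜) (h : p ≤ l) :
    truncatedSequence l b p = b p := if_pos h

theorem truncatedSequence_apply_of_lt {l p : ℕ+} (b : ℕ+ → 𝕜) (h : l < p) :
    truncatedSequence l b p = 0 := if_neg h.not_ge

theorem exists_forall_gt_norm_apply_lt {N : ℕ} (y : Fin N → C₀(ℕ+, 𝕜)) {ε : ℝ} (hε : 0 < ε) :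
    ∃ l : ℕ+, ∀ s, ∀ p > l, ‖y s p‖ < ε := by
  have hfin : (⋃ s, {p | ε ≤ ‖y s p‖}).Finite :=
    Set.finite_iUnion fun s => finite_setOf_le_norm_apply (y s) hε
  obtain ⟨l, hl⟩ := hfin.bddAbove
  refine ⟨l, fun s p hp => ?_⟩
  by_contra! h
  exact absurd (hl (mem_iUnion.2 ⟨s, h⟩)) (not_le.2 hp)

/-- Truncated sequences with coordinates in a dense set approximate tuples of null sequences. -/
theorem exists_truncatedSequence_near {N : ℕ} {D : Set 𝕜} (hD : Dense D)
    (y : Fin N → C₀(ℕ+, 𝕜)) {ε : ℝ} (hε : 0 < ε) :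
    ∃ (l : ℕ+) (a : Fin N → ℕ+ → 𝕜), (∀ s p, a s p ∈ D) ∧
      ∀ s, ‖truncatedSequence l (a s) - y s‖ < ε := by
  obtain ⟨l, hl⟩ := exists_forall_gt_norm_apply_lt y (half_pos hε)
  choose a haD ha using fun s p => hD.exists_dist_lt (y s p) (half_pos hε)
  refine ⟨l, a, haD, fun s => (norm_le_of_forall_apply (half_pos hε).le fun p => ?_).trans_lt
    (half_lt_self hε)⟩
  rw [ZeroAtInftyContinuousMap.sub_apply]
  rcases le_or_gt p l with hp | hp
  · rw [truncatedSequence_apply_of_le _ hp, ← dist_eq_norm, dist_comm]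
    exact (ha s p).le
  · rw [truncatedSequence_apply_of_lt _ hp, zero_sub, norm_neg]
    exact (hl s p hp).le

end NullSequences

/-! ### Iterates of pseudo-shifts -/

theorem lt_apply_of_strictMono {f : ℕ+ → ℕ+} (hf : StrictMono f) (hf1 : 1 < f 1) (j : ℕ+) :
    j < f j := by
  induction j using PNat.recOn with
  | one => exact hf1
  | succ j ih =>
    have h := hf (PNat.lt_add_right j 1)
    exact (PNat.add_one_le_iff.2 ih).trans_lt h

theorem lt_iterate_of_strictMono {f : ℕ+ → ℕ+} (hf : StrictMono f) (hf1 : 1 < f 1) (n : ℕ)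
    (j : ℕ+) : n < (f^[n] j : ℕ) := by
  induction n with
  | zero => simp
  | succ n ih =>
    rw [Function.iterate_succ_apply']
    have h : (f^[n] j : ℕ) < f (f^[n] j) := lt_apply_of_strictMono hf hf1 _
    omega

theorem weightProd_succ {𝕜 : Type*} [RCLike 𝕜] (f : ℕ+ → ℕ+) (w : ℕ+ → 𝕜) (j : ℕ+) (n : ℕ) :
    weightProd f w j (n + 1) = weightProd f w j n * w (f^[n + 1] j) :=
  Finset.prod_Icc_succ_top (by omega) _

theorem pseudoShift_pow_apply {𝕜 : Type*} [RCLike 𝕜] (f : ℕ+ → ℕ+) (w : ℕ+ → 𝕜)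
    (hf : StrictMono f) (hw : ∃ C : ℝ, ∀ j, ‖w (f j)‖ ≤ C) (n : ℕ) (x : C₀(ℕ+, 𝕜)) (j : ℕ+) :
    (pseudoShift f w hf hw ^ n) x j = weightProd f w j n * x (f^[n] j) := by
  induction n generalizing x with
  | zero => simp [weightProd]
  | succ n ih =>
    rw [pow_succ, mul_apply_eq_comp, ih, pseudoShift_apply, weightProd_succ,
      Function.iterate_succ_apply', mul_assoc]

theorem directSumOp_pow_apply {𝕜 X : Type*} [NormedField 𝕜] [AddCommGroup X] [Module 𝕜 X]
    [TopologicalSpace X] {N : ℕ} (T : Fin N → X →L[𝕜] X) (n : ℕ) (y : Fin N → X) :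
    (directSumOp T ^ n) y = fun s => (T s ^ n) (y s) := by
  induction n generalizing y with
  | zero => simp
  | succ n ih =>
    rw [pow_succ, mul_apply_eq_comp, ih]
    funext s
    rw [pow_succ, mul_apply_eq_comp]
    rfl

/-! ### Disjoint hypercyclicity through Baire category -/

/-- A tuple of operators on a Banach space is disjoint `𝒜`-hypercyclic for an upper family `𝒜` if
every member `y` of a countable dense family of targets can, for each `ε`, be approximated along
some `A ∈ 𝒜` by the orbits of vectors from a dense set, where `A` is independent of that vector up
to finitely many elements. -/
theorem disjointHypercyclic_of_isUpperFamily {𝕜 X : Type*} [NormedField 𝕜]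
    [NormedAddCommGroup X] [NormedSpace 𝕜 X] [CompleteSpace X] {N : ℕ} {𝒜 : Set (Set ℕ)}
    (h𝒜 : IsUpperFamily 𝒜) (T : Fin N → X →L[𝕜] X) {ι : Type*} [Countable ι]
    (y : ι → Fin N → X)
    (hy : ∀ (v : Fin N → X) (ε : ℝ), 0 < ε → ∃ i, ∀ s, ‖y i s - v s‖ < ε)
    (h : ∀ (i : ι) (ε : ℝ), 0 < ε → ∃ A ∈ 𝒜, ∀ (u : X) (η : ℝ), 0 < η →
      ∃ (x : X) (n₀ : ℕ), ‖x - u‖ < η ∧ ∀ n ∈ A, n₀ ≤ n → ∀ s, ‖(T s ^ n) x - y i s‖ < ε) :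
    DisjointHypercyclic 𝒜 T := by
  choose A hA hA' using fun (i : ι) (q : ℕ) => h i (1 / ((q : ℝ) + 1)) Nat.one_div_pos_of_nat
  choose F hF hF' using fun (i : ι) (q : ℕ) => h𝒜 (A i q) (hA i q)
  -- Finiteness of `S` makes these sets open. The witnesses come from `A i q` alone, not from the
  -- vector being approximated, so one set `E c` meets every ball.
  let E : ι × ℕ × ℕ → Set X := fun c =>
    ⋃ S ∈ F c.1 c.2.1 c.2.2, ⋂ n ∈ S, ⋂ s : Fin N,
      {x | ‖(T s ^ n) x - y c.1 s‖ < 1 / ((c.2.1 : ℝ) + 1)}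
  have hopen : ∀ c, IsOpen (E c) := fun c => by
    refine isOpen_biUnion fun S _ => isOpen_biInter_finset fun n _ => isOpen_iInter_of_finite
      fun s => isOpen_lt (by fun_prop) continuous_const
  have hdense : ∀ c, Dense (E c) := fun c => by
    obtain ⟨i, q, m⟩ := c
    refine Metric.dense_iff.2 fun u η hη => ?_
    obtain ⟨x, n₀, hxu, hx⟩ := hA' i q u η hη
    obtain ⟨S, hS, hSA⟩ := hF i q m n₀
    refine ⟨x, by rwa [Metric.mem_ball, dist_eq_norm], ?_⟩
    simp only [E, mem_iUnion, mem_iInter, mem_ofPred_eq]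
    exact ⟨S, hS, fun n hn s => hx n (hSA n hn).1 (hSA n hn).2 s⟩
  obtain ⟨x, hx⟩ := (dense_iInter_of_isOpen hopen hdense).nonempty
  refine ⟨x, fun U hU hUne => ?_⟩
  obtain ⟨v, hv⟩ := hUne
  obtain ⟨ε, hε, hball⟩ := Metric.isOpen_iff.1 hU v hv
  obtain ⟨i, hi⟩ := hy v (ε / 2) (half_pos hε)
  obtain ⟨q, hq⟩ := exists_nat_one_div_lt (half_pos hε)
  refine hF' i q _ fun m => ?_
  have hxm := mem_iInter.1 hx (i, q, m)
  simp only [E, mem_iUnion, mem_iInter, mem_ofPred_eq] at hxm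
  obtain ⟨S, hS, hSx⟩ := hxm
  refine ⟨S, hS, fun n hn => hball ?_⟩
  rw [directSumOp_pow_apply, Metric.mem_ball, dist_pi_lt_iff hε]
  intro s
  rw [dist_eq_norm]
  calc ‖(T s ^ n) x - v s‖ ≤ ‖(T s ^ n) x - y i s‖ + ‖y i s - v s‖ :=
        norm_sub_le_norm_sub_add_norm_sub _ _ _
    _ < ε := by linarith [hSx n hn s, hi s]

/-! ### Approximating a target along a set of times -/

section PseudoShifts

variable {𝕜 : Type*} [RCLike 𝕜] {N : ℕ} {f : Fin N → ℕ+ → ℕ+} {w : Fin N → ℕ+ → 𝕜}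

/-- For weights growing along `A`, there is a null sequence of small norm that vanishes off the
points `f_s^n(j)` with `j ≤ l` and `n ∈ A` large, and equals `a_{s,j} / W^s_{j,n}` for one of the
representations of each such point. -/
theorem exists_nullSequence_weights (l : ℕ+) (a : Fin N → ℕ+ → 𝕜) {A : Set ℕ}
    (hA : ∀ j ≤ l, ∀ s,
      Tendsto (fun n => ‖weightProd (f s) (w s) j n‖) (atTop ⊓ 𝓟 A) atTop)
    (n₁ : ℕ) {η : ℝ} (hη : 0 < η) :
    ∃ n₀ ≥ n₁, ∃ z : C₀(ℕ+, 𝕜), ‖z‖ ≤ η ∧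
      (∀ n ∈ A, n₀ ≤ n → ∀ j ≤ l, ∀ s, weightProd (f s) (w s) j n ≠ 0) ∧
      ∀ p, (z p = 0 ∧ ∀ n ∈ A, n₀ ≤ n → ∀ j ≤ l, ∀ s, (f s)^[n] j ≠ p) ∨
        ∃ n ∈ A, n₀ ≤ n ∧ ∃ j ≤ l, ∃ s, (f s)^[n] j = p ∧
          z p = a s j / weightProd (f s) (w s) j n := by
  classical
  have hlarge : ∀ R : ℝ, ∃ n₀ : ℕ, ∀ n ∈ A, n₀ ≤ n → ∀ j ≤ l, ∀ s,
      R < ‖weightProd (f s) (w s) j n‖ := by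
    intro R
    have h : ∀ᶠ n in atTop ⊓ 𝓟 A, ∀ j ∈ Iic l, ∀ s, R < ‖weightProd (f s) (w s) j n‖ :=
      ((Set.finite_Iic l).eventually_all).2 fun j hj => eventually_all.2 fun s =>
        (hA j hj s).eventually_gt_atTop R
    rw [eventually_inf_principal, eventually_atTop] at h
    obtain ⟨n₀, hn₀⟩ := h
    exact ⟨n₀, fun n hn hle => hn₀ n hle hn⟩
  obtain ⟨C, hC0, hC⟩ : ∃ C : ℝ, 0 < C ∧ ∀ j ≤ l, ∀ s, ‖a s j‖ ≤ C := by
    obtain ⟨C, hC⟩ := (((Set.finite_Iic l).prod (Set.finite_univ (α := Fin N))).image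
      fun c => ‖a c.2 c.1‖).bddAbove
    refine ⟨max C 1, by positivity, fun j hj s => le_max_of_le_left (hC ⟨(j, s), ?_, rfl⟩)⟩
    exact ⟨hj, mem_univ _⟩
  have hsmall : ∀ ε : ℝ, 0 < ε → ∃ n₀ : ℕ, ∀ n ∈ A, n₀ ≤ n → ∀ j ≤ l, ∀ s,
      ‖a s j / weightProd (f s) (w s) j n‖ < ε ∧ weightProd (f s) (w s) j n ≠ 0 := by
    intro ε hε
    obtain ⟨n₀, hn₀⟩ := hlarge (C / ε)
    refine ⟨n₀, fun n hn hle j hj s => ?_⟩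
    have h := hn₀ n hn hle j hj s
    have hpos : 0 < ‖weightProd (f s) (w s) j n‖ := (div_pos hC0 hε).trans h
    refine ⟨?_, norm_pos_iff.1 hpos⟩
    rw [norm_div, div_lt_iff₀ hpos]
    rw [div_lt_iff₀ hε] at h
    linarith [hC j hj s]
  obtain ⟨n₂, hn₂⟩ := hsmall η hη
  -- A point may have several representations `f_s^n(j)`; any one is chosen here, and the
  -- discrepancy is handled later by separation and condition 3.
  have key : ∀ p, ∃ v : 𝕜,
      (v = 0 ∧ ∀ n ∈ A, max n₁ n₂ ≤ n → ∀ j ≤ l, ∀ s, (f s)^[n] j ≠ p) ∨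
        ∃ n ∈ A, max n₁ n₂ ≤ n ∧ ∃ j ≤ l, ∃ s, (f s)^[n] j = p ∧
          v = a s j / weightProd (f s) (w s) j n := by
    intro p
    by_cases hp : ∃ n ∈ A, max n₁ n₂ ≤ n ∧ ∃ j ≤ l, ∃ s, (f s)^[n] j = p
    · obtain ⟨n, hn, hle, j, hj, s, h⟩ := hp
      exact ⟨_, Or.inr ⟨n, hn, hle, j, hj, s, h, rfl⟩⟩
    · push Not at hp
      exact ⟨0, Or.inl ⟨rfl, hp⟩⟩
  choose g hg using key
  -- Values of size at least `ε` arise only from the finitely many triples `(n, j, s)` with `n <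
  -- n₃`.
  have hnull : ∀ ε : ℝ, 0 < ε → {p | ε ≤ ‖g p‖}.Finite := by
    intro ε hε
    obtain ⟨n₃, hn₃⟩ := hsmall ε hε
    refine (((Set.finite_Iio n₃).prod ((Set.finite_Iic l).prod
      (Set.finite_univ (α := Fin N)))).image fun c => (f c.2.2)^[c.1] c.2.1).subset fun p hp => ?_
    have hp' : ε ≤ ‖g p‖ := hp
    rcases hg p with ⟨h0, -⟩ | ⟨n, hn, -, j, hj, s, hjp, hv⟩
    · rw [h0, norm_zero] at hp'
      linarith
    · refine ⟨(n, j, s), ⟨?_, hj, mem_univ _⟩, hjp⟩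
      by_contra hlt
      have := (hn₃ n hn (not_lt.1 hlt) j hj s).1
      rw [← hv] at this
      linarith
  refine ⟨max n₁ n₂, le_max_left _ _, nullSequence g hnull, ?_, ?_, hg⟩
  · refine norm_le_of_forall_apply hη.le fun p => ?_
    rw [nullSequence_apply]
    rcases hg p with ⟨h0, -⟩ | ⟨n, hn, hle, j, hj, s, -, hv⟩
    · rw [h0, norm_zero]
      exact hη.le
    · rw [hv]
      exact (hn₂ n hn ((le_max_right _ _).trans hle) j hj s).1.le
  · exact fun n hn hle j hj s => (hn₂ n hn ((le_max_right _ _).trans hle) j hj s).2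

/-- Under the growth and compatibility conditions along a separated set `A`, every vector can be
perturbed so that its orbits are near the target `(a_{s,1}, …, a_{s,l}, 0, …)` at all late times
in `A`. -/
theorem exists_near_orbit_near_target (hf : ∀ s, StrictMono (f s)) (hf1 : ∀ s, 1 < f s 1)
    (hw : ∀ s, ∃ C : ℝ, ∀ j, ‖w s (f s j)‖ ≤ C) (l : ℕ+) (a : Fin N → ℕ+ → 𝕜)
    (ha : ∀ s, ∀ j ≤ l, a s j ≠ 0) {C ε : ℝ} (hC0 : 0 ≤ C) (hε : 0 ≤ ε)
    (hC : ∀ s, ∀ j ≤ l, ‖a s j‖ ≤ C) {A : Set ℕ}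
    (h1 : ∀ j ≤ l, ∀ s,
      Tendsto (fun n => ‖weightProd (f s) (w s) j n‖) (atTop ⊓ 𝓟 A) atTop)
    (h2 : ∀ j ≤ l, ∀ n ∈ A, ∀ s t, ∀ m ∈ A, ∀ i > l, (f s)^[n] i = (f t)^[m] j →
      ‖weightProd (f s) (w s) i n‖ / ‖weightProd (f t) (w t) j m‖ ≤ ε)
    (h3 : ∀ n ∈ A, ∀ s t, s ≠ t → ∀ i ≤ l, ∀ j ≤ l, (f s)^[n] i = (f t)^[n] j →
      ‖weightProd (f s) (w s) i n / weightProd (f t) (w t) j n - a s i / a t j‖ ≤ ε)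
    (hsep : ∀ m ∈ A, ∀ n ∈ A, m ≠ n → ∀ s t : Fin N,
      ((f s)^[m] '' Iic l) ∩ ((f t)^[n] '' Iic l) = ∅)
    (u : C₀(ℕ+, 𝕜)) {η : ℝ} (hη : 0 < η) :
    ∃ (x : C₀(ℕ+, 𝕜)) (n₀ : ℕ), ‖x - u‖ < η ∧ ∀ n ∈ A, n₀ ≤ n → ∀ s,
      ‖(pseudoShift (f s) (w s) (hf s) (hw s) ^ n) x - truncatedSequence l (a s)‖ ≤ C * ε := by
  obtain ⟨k, b, -, hb⟩ := exists_truncatedSequence_near (N := 1) (dense_univ (X := 𝕜))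
    (fun _ => u) (half_pos hη)
  obtain ⟨n₀, hn₀, z, hz, hW, hzp⟩ :=
    exists_nullSequence_weights l a h1 k (η := η / 4) (by positivity)
  refine ⟨truncatedSequence k (b 0) + z, n₀, ?_, fun n hn hle s => ?_⟩
  · have h := norm_add_le (truncatedSequence k (b 0) - u) z
    rw [add_sub_right_comm]
    linarith [hb 0]
  refine norm_le_of_forall_apply (by positivity) fun i => ?_
  -- From `n ≥ n₀ ≥ k` the orbit reads `x` only beyond the support of the truncation of `u`, so only
  -- `z` contributes.
  have hk : k < (f s)^[n] i := by
    have := lt_iterate_of_strictMono (hf s) (hf1 s) n i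
    exact PNat.coe_lt_coe _ _ |>.1 (by omega)
  rw [ZeroAtInftyContinuousMap.sub_apply, pseudoShift_pow_apply, ZeroAtInftyContinuousMap.add_apply,
    truncatedSequence_apply_of_lt _ hk, zero_add]
  have hpos : 0 ≤ C * ε := by positivity
  rcases le_or_gt i l with hi | hi
  · rw [truncatedSequence_apply_of_le _ hi]
    rcases hzp ((f s)^[n] i) with ⟨-, h0⟩ | ⟨m, hm, -, j, hj, t, hjp, hv⟩
    · exact absurd rfl (h0 n hn hle i hi s)
    obtain rfl : m = n := by
      by_contra hmn
      have hmem : (f s)^[n] i ∈ ((f t)^[m] '' Iic l) ∩ ((f s)^[n] '' Iic l) :=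
        ⟨⟨j, hj, hjp⟩, ⟨i, hi, rfl⟩⟩
      rw [hsep m hm n hn hmn t s] at hmem
      exact hmem
    rw [hv]
    by_cases hst : s = t
    · subst hst
      obtain rfl : j = i := ((hf s).iterate m).injective hjp
      rw [mul_div_cancel₀ _ (hW m hm hle j hj s), sub_self, norm_zero]
      exact hpos
    · have hat := ha t j hj
      have heq : weightProd (f s) (w s) i m * (a t j / weightProd (f t) (w t) j m) - a s i =
          a t j * (weightProd (f s) (w s) i m / weightProd (f t) (w t) j m - a s i / a t j) := by
        rw [mul_sub, mul_div_cancel₀ _ hat]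
        ring
      rw [heq, norm_mul]
      exact mul_le_mul (hC t j hj) (h3 m hm s t hst i hi j hj hjp.symm) (norm_nonneg _) hC0
  · rw [truncatedSequence_apply_of_lt _ hi, sub_zero]
    rcases hzp ((f s)^[n] i) with ⟨h0, -⟩ | ⟨m, hm, -, j, hj, t, hjp, hv⟩
    · rw [h0, mul_zero, norm_zero]
      exact hpos
    · have hle2 := h2 j hj n hn s t m hm i hi hjp.symm
      rw [hv, norm_mul, norm_div, mul_div_left_comm]
      exact mul_le_mul (hC t j hj) hle2 (by positivity) hC0

/-- The weight conditions imply disjoint hypercyclicity for an upper family. -/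
theorem disjointHypercyclic_of_weights (hf : ∀ s, StrictMono (f s)) (hf1 : ∀ s, 1 < f s 1)
    (hw : ∀ s, ∃ C : ℝ, ∀ j, ‖w s (f s j)‖ ≤ C)
    {𝒜 : Set (Set ℕ)} (h𝒜 : IsUpperFamily 𝒜) (hreg : AlmostPartitionRegular f 𝒜)
    (h : ∀ l : ℕ+, ∀ a : Fin N → ℕ+ → 𝕜, (∀ s, ∀ j ≤ l, a s j ≠ 0) → ∀ ε : ℝ, 0 < ε →
        ∃ A ∈ 𝒜,
          (∀ j ≤ l, ∀ s,
            Tendsto (fun n => ‖weightProd (f s) (w s) j n‖) (atTop ⊓ 𝓟 A) atTop) ∧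
          (∀ j ≤ l, ∀ n ∈ A, ∀ s t, ∀ m ∈ A, ∀ i > l, (f s)^[n] i = (f t)^[m] j →
            ‖weightProd (f s) (w s) i n‖ / ‖weightProd (f t) (w t) j m‖ ≤ ε) ∧
          (∀ n ∈ A, ∀ s t, s ≠ t → ∀ i ≤ l, ∀ j ≤ l, (f s)^[n] i = (f t)^[n] j →
            ‖weightProd (f s) (w s) i n / weightProd (f t) (w t) j n - a s i / a t j‖ ≤ ε)) :
    DisjointHypercyclic 𝒜 (fun s => pseudoShift (f s) (w s) (hf s) (hw s)) := by
  obtain ⟨D₀, hD₀c, hD₀⟩ := TopologicalSpace.exists_countable_dense 𝕜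
  -- The weight conditions are assumed only for nonzero scalars, so 0 is removed from the target
  -- coordinates.
  have hD : Dense (D₀ \ {0}) := hD₀.sdiff_singleton 0
  have : Countable ↥(D₀ \ {0}) := (hD₀c.mono sdiff_subset).to_subtype
  let ext : (Σ l : ℕ+, Fin N → Iic l → ↥(D₀ \ {0})) → Fin N → ℕ+ → 𝕜 := fun c s p =>
    if hp : p ≤ c.1 then (c.2 s ⟨p, hp⟩ : 𝕜) else 1
  refine disjointHypercyclic_of_isUpperFamily h𝒜 _
    (fun c s => truncatedSequence c.1 (ext c s)) ?_ ?_
  · intro v ε hε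
    obtain ⟨l, a, haD, ha⟩ := exists_truncatedSequence_near hD v hε
    refine ⟨⟨l, fun s p => ⟨a s p, haD s p⟩⟩, fun s => ?_⟩
    refine lt_of_eq_of_lt (congrArg (fun z => ‖z - v s‖) ?_) (ha s)
    ext p
    rcases le_or_gt p l with hp | hp
    · rw [truncatedSequence_apply_of_le _ hp, truncatedSequence_apply_of_le _ hp]
      exact dif_pos hp
    · rw [truncatedSequence_apply_of_lt _ hp, truncatedSequence_apply_of_lt _ hp]
  · intro c r hr
    have hext : ∀ s, ∀ j ≤ c.1, ext c s j ≠ 0 := fun s j hj => by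
      simp only [ext, dif_pos hj]
      exact (c.2 s ⟨j, hj⟩).2.2
    obtain ⟨C, hC0, hC⟩ : ∃ C : ℝ, 0 < C ∧ ∀ s, ∀ j ≤ c.1, ‖ext c s j‖ ≤ C := by
      obtain ⟨C, hC⟩ := (((Set.finite_univ (α := Fin N)).prod (Set.finite_Iic c.1)).image
        fun q => ‖ext c q.1 q.2‖).bddAbove
      refine ⟨max C 1, by positivity, fun s j hj => le_max_of_le_left (hC ⟨(s, j), ?_, rfl⟩)⟩
      exact ⟨mem_univ _, hj⟩
    obtain ⟨B, hB, h1, h2, h3⟩ := h c.1 (ext c) hext (r / (2 * C)) (by positivity)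
    obtain ⟨A, hA, hAB, hsep⟩ := hreg c.1 B hB
    refine ⟨A, hA, fun u η hη => ?_⟩
    obtain ⟨x, n₀, hxu, hx⟩ := exists_near_orbit_near_target hf hf1 hw c.1 (ext c) hext hC0.le
      (by positivity) hC
      (fun j hj s => (h1 j hj s).mono_left (inf_le_inf_left _ (principal_mono.2 hAB)))
      (fun j hj n hn s t m hm => h2 j hj n (hAB hn) s t m (hAB hm))
      (fun n hn => h3 n (hAB hn)) hsep u hη
    refine ⟨x, n₀, hxu, fun n hn hle s => (hx n hn hle s).trans_lt ?_⟩
    rw [show C * (r / (2 * C)) = r / 2 by field_simp]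
    exact half_lt_self hr

/-- Disjoint hypercyclicity implies the weight conditions, for any family. -/
theorem weights_of_disjointHypercyclic (hf : ∀ s, StrictMono (f s)) (hf1 : ∀ s, 1 < f s 1)
    (hw : ∀ s, ∃ C : ℝ, ∀ j, ‖w s (f s j)‖ ≤ C) {𝒜 : Set (Set ℕ)}
    (h : DisjointHypercyclic 𝒜 (fun s => pseudoShift (f s) (w s) (hf s) (hw s)))
    (l : ℕ+) (a : Fin N → ℕ+ → 𝕜) (ha : ∀ s, ∀ j ≤ l, a s j ≠ 0) {ε : ℝ} (hε : 0 < ε) :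
    ∃ A ∈ 𝒜,
      (∀ j ≤ l, ∀ s,
        Tendsto (fun n => ‖weightProd (f s) (w s) j n‖) (atTop ⊓ 𝓟 A) atTop) ∧
      (∀ j ≤ l, ∀ n ∈ A, ∀ s t, ∀ m ∈ A, ∀ i > l, (f s)^[n] i = (f t)^[m] j →
        ‖weightProd (f s) (w s) i n‖ / ‖weightProd (f t) (w t) j m‖ ≤ ε) ∧
      (∀ n ∈ A, ∀ s t, s ≠ t → ∀ i ≤ l, ∀ j ≤ l, (f s)^[n] i = (f t)^[n] j →
        ‖weightProd (f s) (w s) i n / weightProd (f t) (w t) j n - a s i / a t j‖ ≤ ε) := by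
  obtain ⟨x, hx⟩ := h
  obtain ⟨c, hc0, hc⟩ : ∃ c : ℝ, 0 < c ∧ ∀ s, ∀ j ≤ l, c ≤ ‖a s j‖ := by
    have hfin := ((Set.finite_univ (α := Fin N)).prod (Set.finite_Iic l)).image
      fun q => ‖a q.1 q.2‖⁻¹
    obtain ⟨C, hC⟩ := hfin.bddAbove
    refine ⟨(max C 1)⁻¹, by positivity, fun s j hj => ?_⟩
    rw [inv_le_comm₀ (by positivity) (norm_pos_iff.2 (ha s j hj))]
    exact le_max_of_le_left (hC ⟨(s, j), ⟨mem_univ _, hj⟩, rfl⟩)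
  obtain ⟨C, hC0, hC⟩ : ∃ C : ℝ, 0 < C ∧ ∀ s, ∀ j ≤ l, ‖a s j‖ ≤ C := by
    obtain ⟨C, hC⟩ := (((Set.finite_univ (α := Fin N)).prod (Set.finite_Iic l)).image
      fun q => ‖a q.1 q.2‖).bddAbove
    refine ⟨max C 1, by positivity, fun s j hj => le_max_of_le_left (hC ⟨(s, j), ?_, rfl⟩)⟩
    exact ⟨mem_univ _, hj⟩
  -- The first bound keeps the products at indices up to `l` at least `c / 2` in norm; the other two
  -- give conditions 2 and 3 respectively.
  obtain ⟨δ, hδ0, hδc, hδε, hδε'⟩ : ∃ δ : ℝ, 0 < δ ∧ δ ≤ c / 2 ∧ δ ≤ ε * (c / 2) ∧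
      δ * (1 + C / c) ≤ ε * (c / 2) := by
    have hK : 1 ≤ 1 + C / c := by linarith [div_pos hC0 hc0]
    refine ⟨min (c / 2) (ε * (c / 2) / (1 + C / c)), by positivity, min_le_left _ _,
      (min_le_right _ _).trans (div_le_self (by positivity) hK), ?_⟩
    rw [← le_div_iff₀ (by positivity)]
    exact min_le_right _ _
  refine ⟨_, hx (Metric.ball (fun s => truncatedSequence l (a s)) δ) Metric.isOpen_ball
    ⟨_, Metric.mem_ball_self hδ0⟩, ?_⟩
  have horb : ∀ n ∈ {n : ℕ | (directSumOp (fun s => pseudoShift (f s) (w s) (hf s) (hw s)) ^ n)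
      (fun _ => x) ∈ Metric.ball (fun s => truncatedSequence l (a s)) δ}, ∀ s i,
      ‖weightProd (f s) (w s) i n * x ((f s)^[n] i) - truncatedSequence l (a s) i‖ ≤ δ := by
    intro n hn s i
    rw [mem_ofPred_eq, directSumOp_pow_apply, Metric.mem_ball, dist_pi_lt_iff hδ0] at hn
    have h := hn s
    rw [dist_eq_norm] at h
    rw [← pseudoShift_pow_apply (f s) (w s) (hf s) (hw s), ← ZeroAtInftyContinuousMap.sub_apply]
    exact (norm_apply_le_norm _ i).trans h.le
  generalize {n : ℕ | (directSumOp (fun s => pseudoShift (f s) (w s) (hf s) (hw s)) ^ n)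
      (fun _ => x) ∈ Metric.ball (fun s => truncatedSequence l (a s)) δ} = A at horb
  have hin : ∀ n ∈ A, ∀ s, ∀ i ≤ l,
      ‖weightProd (f s) (w s) i n * x ((f s)^[n] i) - a s i‖ ≤ δ := fun n hn s i hi => by
    simpa only [truncatedSequence_apply_of_le _ hi] using horb n hn s i
  have hout : ∀ n ∈ A, ∀ s, ∀ i > l,
      ‖weightProd (f s) (w s) i n * x ((f s)^[n] i)‖ ≤ δ := fun n hn s i hi => by
    simpa only [truncatedSequence_apply_of_lt _ hi, sub_zero] using horb n hn s i
  have hlow : ∀ n ∈ A, ∀ s, ∀ i ≤ l,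
      c / 2 ≤ ‖weightProd (f s) (w s) i n * x ((f s)^[n] i)‖ := fun n hn s i hi => by
    have h := norm_sub_norm_le (a s i) (weightProd (f s) (w s) i n * x ((f s)^[n] i))
    rw [norm_sub_rev] at h
    linarith [hin n hn s i hi, hc s i hi]
  have hne : ∀ n ∈ A, ∀ s, ∀ i ≤ l,
      weightProd (f s) (w s) i n ≠ 0 ∧ x ((f s)^[n] i) ≠ 0 := fun n hn s i hi =>
    mul_ne_zero_iff.1 (norm_pos_iff.1 ((half_pos hc0).trans_le (hlow n hn s i hi)))
  refine ⟨fun j hj s => ?_, fun j hj n hn s t m hm i hi hij => ?_,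
    fun n hn s t _ i hi j hj hij => ?_⟩
  · refine tendsto_atTop.2 fun R => ?_
    have hR : 0 < |R| + 1 := by positivity
    obtain ⟨k, hk⟩ := exists_forall_gt_norm_apply_lt (N := 1) (fun _ => x)
      (ε := c / 2 / (|R| + 1)) (by positivity)
    rw [eventually_inf_principal]
    filter_upwards [eventually_ge_atTop (k : ℕ)] with n hkn hn
    have hkp : k < (f s)^[n] j := by
      have := lt_iterate_of_strictMono (hf s) (hf1 s) n j
      exact PNat.coe_lt_coe _ _ |>.1 (by omega)
    have hxs := hk 0 _ hkp
    have hlo := hlow n hn s j hj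
    rw [norm_mul] at hlo
    rw [lt_div_iff₀ hR] at hxs
    have hxpos := norm_pos_iff.2 (hne n hn s j hj).2
    have hlt : ‖x ((f s)^[n] j)‖ * (|R| + 1) <
        ‖x ((f s)^[n] j)‖ * ‖weightProd (f s) (w s) j n‖ := by
      linarith
    have := lt_of_mul_lt_mul_left hlt hxpos.le
    linarith [le_abs_self R]
  · have ho := hout n hn s i hi
    have hlo := hlow m hm t j hj
    obtain ⟨hW, hx0⟩ := hne m hm t j hj
    rw [hij] at ho
    rw [← mul_div_mul_right _ _ (norm_ne_zero_iff.2 hx0), ← norm_mul, ← norm_mul,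
      div_le_iff₀ ((half_pos hc0).trans_le hlo)]
    calc _ ≤ δ := ho
      _ ≤ ε * (c / 2) := hδε
      _ ≤ _ := by gcongr
  · have hs := hin n hn s i hi
    have ht := hin n hn t j hj
    have hlo := hlow n hn t j hj
    obtain ⟨hW, hx0⟩ := hne n hn t j hj
    rw [hij] at hs
    have hat := ha t j hj
    set P := weightProd (f s) (w s) i n * x ((f t)^[n] j) with hP
    set Q := weightProd (f t) (w t) j n * x ((f t)^[n] j) with hQ
    have hQ0 : Q ≠ 0 := mul_ne_zero hW hx0
    -- The common coordinate of `x` cancels in `P / Q`, and the deviation of this quotient from `a s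
    -- i / a t j` is linear in the errors of `P` and `Q`, over `Q`.
    have heq : weightProd (f s) (w s) i n / weightProd (f t) (w t) j n - a s i / a t j =
        ((P - a s i) - a s i / a t j * (Q - a t j)) / Q := by
      rw [← mul_div_mul_right _ _ hx0, ← hP, ← hQ]
      field_simp
      ring
    rw [heq, norm_div, div_le_iff₀ ((half_pos hc0).trans_le hlo)]
    have hq : ‖a s i / a t j‖ ≤ C / c := by
      rw [norm_div]
      exact div_le_div₀ hC0.le (hC s i hi) hc0 (hc t j hj)
    calc ‖(P - a s i) - a s i / a t j * (Q - a t j)‖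
        ≤ ‖P - a s i‖ + ‖a s i / a t j‖ * ‖Q - a t j‖ := by
          rw [← norm_mul]
          exact norm_sub_le _ _
      _ ≤ δ + C / c * δ := by gcongr
      _ = δ * (1 + C / c) := by ring
      _ ≤ ε * (c / 2) := hδε'
      _ ≤ ε * ‖Q‖ := by gcongr

end PseudoShifts

/-- As each `f s` is injective, `i` in the last two conditions is the preimage
`f_s^{-n}(f_t^m(j))`, resp. the pair `(i, j)` is `(f_s^{-n}(k), f_t^{-n}(k))` for a point `k` of
`f_s^n([l]) ∩ f_t^n([l])`. -/
theorem mainTheorem8 {𝕜 : Type*} [RCLike 𝕜] (N : ℕ) (hN : 2 ≤ N)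
    (f : Fin N → ℕ+ → ℕ+) (w : Fin N → ℕ+ → 𝕜)
    (hf : ∀ s, StrictMono (f s)) (hf1 : ∀ s, 1 < f s 1)
    (hw : ∀ s, ∃ C : ℝ, ∀ j, ‖w s (f s j)‖ ≤ C)
    (𝒜 : Set (Set ℕ)) (h𝒜 : 𝒜 = familyUBd ∨ 𝒜 = familyUd)
    (hreg : AlmostPartitionRegular f 𝒜) :
    DisjointHypercyclic 𝒜 (fun s => pseudoShift (f s) (w s) (hf s) (hw s)) ↔
      ∀ l : ℕ+, ∀ a : Fin N → ℕ+ → 𝕜, (∀ s, ∀ j ≤ l, a s j ≠ 0) → ∀ ε : ℝ, 0 < ε →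
        ∃ A ∈ 𝒜,
          (∀ j ≤ l, ∀ s,
            Tendsto (fun n => ‖weightProd (f s) (w s) j n‖) (atTop ⊓ 𝓟 A) atTop) ∧
          (∀ j ≤ l, ∀ n ∈ A, ∀ s t, ∀ m ∈ A, ∀ i > l, (f s)^[n] i = (f t)^[m] j →
            ‖weightProd (f s) (w s) i n‖ / ‖weightProd (f t) (w t) j m‖ ≤ ε) ∧
          (∀ n ∈ A, ∀ s t, s ≠ t → ∀ i ≤ l, ∀ j ≤ l, (f s)^[n] i = (f t)^[n] j →
            ‖weightProd (f s) (w s) i n / weightProd (f t) (w t) j n - a s i / a t j‖ ≤ ε) := by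
  have hup : IsUpperFamily 𝒜 := by
    rcases h𝒜 with rfl | rfl
    · exact isUpperFamily_familyUBd
    · exact isUpperFamily_familyUd
  exact ⟨fun h l a ha ε hε => weights_of_disjointHypercyclic hf hf1 hw h l a ha hε,
    fun h => disjointHypercyclic_of_weights hf hf1 hw hup hreg h⟩
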